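/- Let $G$ be a non-compact real reductive Lie group with Cartan involution $\theta$: $G$ has finitely many connected components, its Lie algebra is $\mathfrak g=[\mathfrak g,\mathfrak g]\oplus\mathfrak z(\mathfrak g)$ with $[\mathfrak g,\mathfrak g]$ semisimple, and $\theta$ is a smooth involutive automorphism of $G$ whose fixed point group $K$ is compact (it is then a maximal compact subgroup) and such that, if $\mathfrak k$ and $\mathfrak p$ denote the $(+1)$- and $(-1)$-eigenspaces of $d\theta$ on $\mathfrak g$, the map $K\times\mathfrak p\to G$, $(k,v)\mapsto k\exp v$, is a diffeomorphism. Let $G$ act continuously on a Hausdorff topological space $\mathscr M$, and let $\Psi:\mathscr M\times G\to\mathbb R$ be a Kempf–Ness function for $(\mathscr M,G,K)$, that is: - (P1) $\Psi(x,\cdot)$ is smooth on $G$ for every $x\in\mathscr M$; - (P2) $\Psi(x,kg)=\Psi(x,g)$ for all $x\in\mathscr M$, $k\in K$, $g\in G$; - (P3) $\frac{d^2}{dt^2}\Psi(x,\exp(tv))\ge 0$ for all $x\in\mathscr M$, $v\in\mathfrak p$, $t\in\mathbb R$, and $\frac{d^2}{dt^2}\big|_{t=0}\Psi(x,\exp(tv))=0$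 if and only if $\exp(\mathbb Rv)\subset G_x$, the stabilizer of $x$; - (P4) $\Psi(x,g)+\Psi(gx,h)=\Psi(x,hg)$ for all $x\in\mathscr M$, $g,h\in G$; - (P5) the gradient map $\mathfrak F:\mathscr M\to\mathfrak p^*$, $\langle\mathfrak F(x),v\rangle=\frac{d}{dt}\big|_{t=0}\Psi(x,\exp(tv))$, is continuous. Let $H\subset G$ be a closed subgroup with Lie algebra $\mathfrak h$ such that $H=(H\cap K)\exp(\mathfrak h\cap\mathfrak p)$. A point $x\in\mathscr M$ is called $H$-stable if 1. there is $h\in H$ such that $\mathfrak F(hx)$ vanishes on $\mathfrak h\cap\mathfrak p$, and 2. the Lie algebra $\mathfrak h_x$ of the stabilizer $H_x=H\cap G_x$ is conjugate, under $\mathrm{Ad}(H)$, to a subalgebra of $\mathfrak h\cap\mathfrak k$. Then a point $x\in\mathscr M$ is $G$-stable if and only if it is $A$-stable for every abelian group $A=\exp(\mathfrak a)$, where $\mathfrak a$ is a subalgebra of $\mathfrak g$ contained in $\mathfrak p$. (For such an $A$ one has $\mathfrak h=\mathfrak h\cap\mathfrak p=\mathfrak a$ and $\mathfrak h\cap\mathfrak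 k=0$.) -/

import Mathlib

open scoped Manifold ContDiff

noncomputable section

namespace KempfNess

/-! ### The exponential map of a Lie group

Lie groups are smooth groups modelled on a finite-dimensional real vector space `E`; the Lie algebra
is `GroupLieAlgebra 𝓘(ℝ, E) G`, the tangent space at `1` with the bracket of left-invariant vector
fields. -/

/-- A smooth real Lie group has the order of smoothness that Mathlib asks for in order to put the
Lie bracket on its tangent space at the identity. -/
instance instLieGroupMinSmoothness {E : Type*} [NormedAddCommGroup E] [NormedSpace ℝ E]
    {G : Type*} [TopologicalSpace G] [ChartedSpace E G] [Group G] [LieGroup 𝓘(ℝ, E) ∞ G] :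
    LieGroup 𝓘(ℝ, E) (minSmoothness ℝ 3) G := by
  rw [minSmoothness_of_isRCLikeNormedField]
  infer_instance

theorem contMDiff_one_mulInvariantVectorField {E : Type*} [NormedAddCommGroup E] [NormedSpace ℝ E]
    {G : Type*} [TopologicalSpace G] [ChartedSpace E G] [Group G] [LieGroup 𝓘(ℝ, E) ∞ G]
    (v : GroupLieAlgebra 𝓘(ℝ, E) G) :
    ContMDiff 𝓘(ℝ, E) 𝓘(ℝ, E).tangent 1
      (fun g : G => (⟨g, mulInvariantVectorField v g⟩ : TangentBundle 𝓘(ℝ, E) G)) :=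
  (contMDiff_mulInvariantVectorField v).of_le (by simp)

/-- Left translation permutes the integral curves of a left-invariant vector field. -/
theorem isMIntegralCurveOn_mul_left {E : Type*} [NormedAddCommGroup E] [NormedSpace ℝ E]
    {G : Type*} [TopologicalSpace G] [ChartedSpace E G] [Group G] [LieGroup 𝓘(ℝ, E) ∞ G]
    {v : GroupLieAlgebra 𝓘(ℝ, E) G} {γ : ℝ → G} {s : Set ℝ}
    (hγ : IsMIntegralCurveOn γ (mulInvariantVectorField v) s) (h : G) :
    IsMIntegralCurveOn (fun t => h * γ t) (mulInvariantVectorField v) s := by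
  intro t ht
  have hd (a b : G) : MDifferentiableAt 𝓘(ℝ, E) 𝓘(ℝ, E) (fun x : G => a * x) b :=
    (contMDiff_mul_left (I := 𝓘(ℝ, E)) (n := ∞) (a := a)).mdifferentiableAt (by simp)
  have key : mulInvariantVectorField v (h * γ t) =
      mfderiv 𝓘(ℝ, E) 𝓘(ℝ, E) (fun x : G => h * x) (γ t) (mulInvariantVectorField v (γ t)) := by
    have e : (fun x : G => h * γ t * x) = (fun x : G => h * x) ∘ (fun x : G => γ t * x) := by
      funext x
      simp [mul_assoc]
    have h1 : MDifferentiableAt 𝓘(ℝ, E) 𝓘(ℝ, E) (fun x : G => h * x) (γ t * 1) := hd h _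
    have := mfderiv_comp_apply (I'' := 𝓘(ℝ, E)) (1 : G) h1 (hd (γ t) 1) v
    rw [← e] at this
    refine this.trans ?_
    have h3 : ∀ b : G, b = γ t → ∀ w : E,
        (mfderiv 𝓘(ℝ, E) 𝓘(ℝ, E) (fun x : G => h * x) b : E → E) w =
          (mfderiv 𝓘(ℝ, E) 𝓘(ℝ, E) (fun x : G => h * x) (γ t) : E → E) w := by
      rintro b rfl w
      rfl
    exact h3 _ (mul_one _) _
  have h2 := (hd h (γ t)).hasMFDerivAt.comp_hasMFDerivWithinAt t (hγ t ht)
  refine h2.congr_mfderiv (ContinuousLinearMap.ext fun a => ?_)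
  rw [key]
  exact map_smul (mfderiv 𝓘(ℝ, E) 𝓘(ℝ, E) (fun x : G => h * x) (γ t)) (show ℝ from a) _

/-- Every left-invariant vector field has a global integral curve through the identity. -/
theorem exists_isMIntegralCurve_one {E : Type*} [NormedAddCommGroup E] [NormedSpace ℝ E]
    [FiniteDimensional ℝ E] {G : Type*} [TopologicalSpace G] [ChartedSpace E G] [Group G]
    [LieGroup 𝓘(ℝ, E) ∞ G] [T2Space G] (v : GroupLieAlgebra 𝓘(ℝ, E) G) :
    ∃ γ : ℝ → G, γ 0 = 1 ∧ IsMIntegralCurve γ (mulInvariantVectorField v) := by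
  have : CompleteSpace E := FiniteDimensional.complete ℝ E
  have hv := contMDiff_one_mulInvariantVectorField v
  obtain ⟨γ, h0, hγ⟩ :=
    exists_isMIntegralCurveAt_of_contMDiffAt_boundaryless 0 (hv.contMDiffAt (x := (1 : G)))
  obtain ⟨ε, hε, hγ⟩ := isMIntegralCurveAt_iff'.mp hγ
  rw [Real.ball_eq_Ioo, zero_sub, zero_add] at hγ
  exact exists_isMIntegralCurve_of_isMIntegralCurveOn hv hε
    (fun x => ⟨fun t => x * γ t, by simp [h0], isMIntegralCurveOn_mul_left hγ x⟩) 1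

/-- The exponential map of the Lie group `G`: `lieExp v` is the value at time `1` of the integral
curve through `1` of the left-invariant vector field defined by `v`. -/
def lieExp {E : Type*} [NormedAddCommGroup E] [NormedSpace ℝ E] [FiniteDimensional ℝ E]
    {G : Type*} [TopologicalSpace G] [ChartedSpace E G] [Group G] [LieGroup 𝓘(ℝ, E) ∞ G]
    [T2Space G] (v : GroupLieAlgebra 𝓘(ℝ, E) G) : G :=
  (exists_isMIntegralCurve_one v).choose 1

/-- That integral curve is unique, so the choice in `lieExp` is immaterial. -/
theorem lieExp_eq {E : Type*} [NormedAddCommGroup E] [NormedSpace ℝ E] [FiniteDimensional ℝ E]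
    {G : Type*} [TopologicalSpace G] [ChartedSpace E G] [Group G] [LieGroup 𝓘(ℝ, E) ∞ G]
    [T2Space G] (v : GroupLieAlgebra 𝓘(ℝ, E) G) {γ : ℝ → G} (h0 : γ 0 = 1)
    (hγ : IsMIntegralCurve γ (mulInvariantVectorField v)) : lieExp v = γ 1 := by
  have : CompleteSpace E := FiniteDimensional.complete ℝ E
  have h := (exists_isMIntegralCurve_one v).choose_spec
  exact congrFun (isMIntegralCurve_Ioo_eq_of_contMDiff_boundaryless (t₀ := 0)
    (contMDiff_one_mulInvariantVectorField v) h.2 hγ (h.1.trans h0.symm)) 1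

/-- The adjoint action of `g` on the Lie algebra, the differential at `1` of `h ↦ g h g⁻¹`. -/
def lieAd {E : Type*} [NormedAddCommGroup E] [NormedSpace ℝ E]
    {G : Type*} [TopologicalSpace G] [ChartedSpace E G] [Group G]
    (g : G) (v : GroupLieAlgebra 𝓘(ℝ, E) G) : GroupLieAlgebra 𝓘(ℝ, E) G :=
  mfderiv 𝓘(ℝ, E) 𝓘(ℝ, E) (fun h : G => g * h * g⁻¹) 1 v

/-- The Lie algebra of a closed subgroup `S` of `G`, as a subset of the Lie algebra of `G`: the
vectors whose one-parameter group lies in `S`. -/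
def lieOf {E : Type*} [NormedAddCommGroup E] [NormedSpace ℝ E] [FiniteDimensional ℝ E]
    {G : Type*} [TopologicalSpace G] [ChartedSpace E G] [Group G] [LieGroup 𝓘(ℝ, E) ∞ G]
    [T2Space G] (S : Subgroup G) : Set (GroupLieAlgebra 𝓘(ℝ, E) G) :=
  {v | ∀ t : ℝ, lieExp (t • v) ∈ S}

/-! ### Real reductive Lie groups -/

/-- The differential at the identity of an endomorphism `θ` of `G`. -/
def lieDiff {E : Type*} [NormedAddCommGroup E] [NormedSpace ℝ E]
    {G : Type*} [TopologicalSpace G] [ChartedSpace E G] [Group G] (θ : G →* G) :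
    GroupLieAlgebra 𝓘(ℝ, E) G →ₗ[ℝ] GroupLieAlgebra 𝓘(ℝ, E) G :=
  (mfderiv 𝓘(ℝ, E) 𝓘(ℝ, E) θ 1).toLinearMap

/-- The subgroup `K` of fixed points of `θ`. -/
def fixedK {G : Type*} [Group G] (θ : G →* G) : Subgroup G :=
  MonoidHom.eqLocus θ (MonoidHom.id G)

/-- `𝔨`, the `+1`-eigenspace of the differential of `θ`. -/
def lieK (E : Type*) [NormedAddCommGroup E] [NormedSpace ℝ E]
    {G : Type*} [TopologicalSpace G] [ChartedSpace E G] [Group G] (θ : G →* G) :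
    Submodule ℝ (GroupLieAlgebra 𝓘(ℝ, E) G) :=
  Module.End.eigenspace (lieDiff θ) 1

/-- `𝔭`, the `-1`-eigenspace of the differential of `θ`. -/
def lieP (E : Type*) [NormedAddCommGroup E] [NormedSpace ℝ E]
    {G : Type*} [TopologicalSpace G] [ChartedSpace E G] [Group G] (θ : G →* G) :
    Submodule ℝ (GroupLieAlgebra 𝓘(ℝ, E) G) :=
  Module.End.eigenspace (lieDiff θ) (-1)

/-- `G` is a real reductive Lie group with Cartan involution `θ`: it has finitely many connected
components, its Lie algebra is the direct sum of its semisimple derived algebra and its centre, and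
`θ` is a smooth involution whose fixed point group `K` is compact and for which
`K × 𝔭 → G, (k, v) ↦ k exp v` is a homeomorphism (the usual requirement of
a diffeomorphism is stronger). In particular `K` is a maximal compact subgroup. -/
structure IsRealReductive (E : Type*) [NormedAddCommGroup E] [NormedSpace ℝ E]
    [FiniteDimensional ℝ E] {G : Type*} [TopologicalSpace G] [ChartedSpace E G] [Group G]
    [LieGroup 𝓘(ℝ, E) ∞ G] [T2Space G] [CompleteSpace E] (θ : G →* G) : Prop where
  finite_components : Finite (ConnectedComponents G)
  isCompl_center : IsCompl (LieAlgebra.derivedSeries ℝ (GroupLieAlgebra 𝓘(ℝ, E) G) 1)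
    (LieAlgebra.center ℝ (GroupLieAlgebra 𝓘(ℝ, E) G))
  isSemisimple_derived :
    LieAlgebra.IsSemisimple ℝ (LieAlgebra.derivedSeries ℝ (GroupLieAlgebra 𝓘(ℝ, E) G) 1)
  contMDiff_θ : ContMDiff 𝓘(ℝ, E) 𝓘(ℝ, E) ∞ θ
  involutive_θ : Function.Involutive θ
  isCompact_K : IsCompact (fixedK θ : Set G)
  cartan : IsHomeomorph
    (fun q : fixedK θ × lieP E θ =>
      (q.1 : G) * lieExp (q.2 : GroupLieAlgebra 𝓘(ℝ, E) G))

/-! ### Kempf-Ness functions and stability -/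

/-- The gradient map: `⟨𝔉(x), v⟩ = d/dt Ψ(x, exp(tv))` at `t = 0`. It is used for `v ∈ 𝔭`. -/
def gradientMap {E : Type*} [NormedAddCommGroup E] [NormedSpace ℝ E] [FiniteDimensional ℝ E]
    {G : Type*} [TopologicalSpace G] [ChartedSpace E G] [Group G] [LieGroup 𝓘(ℝ, E) ∞ G]
    [T2Space G] {M : Type*} (Ψ : M → G → ℝ) (x : M) (v : GroupLieAlgebra 𝓘(ℝ, E) G) : ℝ :=
  deriv (fun t : ℝ => Ψ x (lieExp (t • v))) 0

/-- `Ψ : M × G → ℝ` is a Kempf-Ness function for `(M, G, K)`. As `𝔭` is finite-dimensional,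
continuity of the gradient map `M → 𝔭*` is continuity of its pairing with each `v ∈ 𝔭`. -/
structure IsKempfNess (E : Type*) [NormedAddCommGroup E] [NormedSpace ℝ E] [FiniteDimensional ℝ E]
    {G : Type*} [TopologicalSpace G] [ChartedSpace E G] [Group G] [LieGroup 𝓘(ℝ, E) ∞ G]
    [T2Space G] (θ : G →* G) {M : Type*} [TopologicalSpace M] [MulAction G M]
    (Ψ : M → G → ℝ) : Prop where
  smooth : ∀ x : M, ContMDiff 𝓘(ℝ, E) 𝓘(ℝ, ℝ) ∞ (Ψ x)
  left_invariant : ∀ (x : M) (g : G), ∀ k ∈ fixedK θ, Ψ x (k * g) = Ψ x g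
  convex : ∀ x : M, ∀ v ∈ lieP E θ, ∀ t : ℝ,
    0 ≤ iteratedDeriv 2 (fun s : ℝ => Ψ x (lieExp (s • v))) t
  convex_eq_zero_iff : ∀ x : M, ∀ v ∈ lieP E θ,
    iteratedDeriv 2 (fun s : ℝ => Ψ x (lieExp (s • v))) 0 = 0 ↔
      ∀ t : ℝ, lieExp (t • v) ∈ MulAction.stabilizer G x
  cocycle : ∀ (x : M) (g h : G), Ψ x g + Ψ (g • x) h = Ψ x (h * g)
  continuous_gradientMap : ∀ v ∈ lieP E θ,
    Continuous (fun x : M => gradientMap Ψ x v)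

/-- `H`-polystability, for a closed subgroup `H = L exp(𝔥 ∩ 𝔭)` of `G` with Lie algebra `𝔥` and
`L = H ∩ K`: the orbit `H x` meets the zero set of the gradient map of `H`, which is `𝔉` restricted
to `𝔥 ∩ 𝔭`. -/
def IsPolystable (E : Type*) [NormedAddCommGroup E] [NormedSpace ℝ E] [FiniteDimensional ℝ E]
    {G : Type*} [TopologicalSpace G] [ChartedSpace E G] [Group G] [LieGroup 𝓘(ℝ, E) ∞ G]
    [T2Space G] (θ : G →* G) {M : Type*} [MulAction G M] (Ψ : M → G → ℝ)
    (H : Subgroup G) (x : M) : Prop :=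
  ∃ h ∈ H, ∀ v : GroupLieAlgebra 𝓘(ℝ, E) G, v ∈ lieOf H → v ∈ lieP E θ →
    gradientMap Ψ (h • x) v = 0

/-- `H`-stability: `x` is `H`-polystable and the Lie algebra `𝔥ₓ` of the stabilizer of `x` in `H` is
conjugate, by an element of `H`, to a subalgebra of `𝔩 = 𝔥 ∩ 𝔨`. For `H = ⊤` this is `G`-stability;
for `H = A = exp 𝔞` with `𝔞 ⊆ 𝔭` one has `𝔥 = 𝔞` and `𝔩 = 0`. -/
def IsStable (E : Type*) [NormedAddCommGroup E] [NormedSpace ℝ E] [FiniteDimensional ℝ E]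
    {G : Type*} [TopologicalSpace G] [ChartedSpace E G] [Group G] [LieGroup 𝓘(ℝ, E) ∞ G]
    [T2Space G] (θ : G →* G) {M : Type*} [MulAction G M] (Ψ : M → G → ℝ)
    (H : Subgroup G) (x : M) : Prop :=
  IsPolystable E θ Ψ H x ∧
    ∃ h ∈ H, ∀ v : GroupLieAlgebra 𝓘(ℝ, E) G, v ∈ lieOf (H ⊓ MulAction.stabilizer G x) →
      lieAd h v ∈ lieOf H ∧ lieAd h v ∈ lieK E θ

end KempfNess

end

/-! A point `x` is `G`-stable exactly when its Kempf-Ness function `Ψ x` is proper and bounded below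
on `G`, and the same properness is equivalent to stability for all abelian groups `exp 𝔞`;
properness (`HasCompactSublevels`) is the bridge between the two sides.

By the Cartan decomposition `G = K exp 𝔭` and `K`-invariance, `Ψ x` is determined by its restriction
to `exp 𝔭 ≅ 𝔭`, where it is convex along every ray. A continuous function on a finite-dimensional
space, convex along rays, has compact sublevel sets as soon as on each ray it exceeds its value at
the origin somewhere (`isCompact_sublevel_of_convexOn_rays`), so properness can be tested ray by ray
(`hasCompactSublevels_of_rays`). It is also invariant under moving `x` in its orbit, by the cocycle
identity.

*Stability implies properness.* Move `x` to a zero `y` of the gradient map. For `v ∈ 𝔭` nonzero,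
`exp (ℝ v)` is not contained in the stabilizer of `y`: it would be conjugate into the compact group
`K`, while `exp` embeds `𝔭` as a closed subset. Hence `t ↦ Ψ y (exp (t v))` is convex, critical at
`0` and has nonzero second derivative there, so it takes positive values
(`IsKempfNess.pos_of_gradientMap_eq_zero`). This settles `G`-stability. For stability along all
abelian groups it suffices to use the lines `𝔞 = ℝ v`, which treat one ray each.

*Properness implies stability.* A proper `Ψ x` attains its minimum on any closed subgroup, and a
minimum is a zero of the gradient map. On the stabilizer of `x` the function `Ψ x` is an additive
character bounded below, so it vanishes (`HasCompactSublevels.apply_eq_zero`), and the stabilizer is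
contained in a compact set. Therefore no nontrivial `exp w` with `w ∈ 𝔭` lies in the stabilizer,
which gives the condition for `exp 𝔞`. At a minimum `y`, an element `k exp u` of the stabilizer
satisfies `Ψ y (exp u) = 0`, so `Ψ y` has its minimum at both ends of the segment from `0` to `u`;
then `exp (ℝ u)` fixes `y` and `u = 0`. So the stabilizer of `y` is contained in `K`, and its Lie
algebra in `𝔨`. -/

open scoped Manifold ContDiff

namespace KempfNess

open Filter Topology Set

/-! ### One-parameter groups -/

section LeftInvariant

variable {E : Type*} [NormedAddCommGroup E] [NormedSpace ℝ E]
  {G : Type*} [TopologicalSpace G] [ChartedSpace E G] [Group G]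

theorem lieAd_smul (g : G) (t : ℝ) (v : GroupLieAlgebra 𝓘(ℝ, E) G) :
    lieAd g (t • v) = t • lieAd g v :=
  map_smul (mfderiv 𝓘(ℝ, E) 𝓘(ℝ, E) (fun h : G => g * h * g⁻¹) 1) t v

theorem lieAd_zero (g : G) : lieAd g (0 : GroupLieAlgebra 𝓘(ℝ, E) G) = 0 :=
  map_zero (mfderiv 𝓘(ℝ, E) 𝓘(ℝ, E) (fun h : G => g * h * g⁻¹) 1)

/-- The derivative of `f` along the left-invariant vector field of `v`. -/
noncomputable def leftDeriv (v : GroupLieAlgebra 𝓘(ℝ, E) G) (f : G → ℝ) (g : G) : ℝ :=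
  (mfderiv 𝓘(ℝ, E) 𝓘(ℝ, ℝ) f g : E →L[ℝ] ℝ) (mulInvariantVectorField v g)

/-- Differentiating along a left-invariant field costs one order of smoothness. The bound `m ≤ 2` is
the order to which a left-invariant field is known to be smooth. -/
theorem contMDiff_leftDeriv [LieGroup 𝓘(ℝ, E) ∞ G] {n m : ℕ∞ω} {f : G → ℝ}
    (hf : ContMDiff 𝓘(ℝ, E) 𝓘(ℝ, ℝ) n f) (hmn : m + 1 ≤ n) (hm : m ≤ 2)
    (v : GroupLieAlgebra 𝓘(ℝ, E) G) : ContMDiff 𝓘(ℝ, E) 𝓘(ℝ, ℝ) m (leftDeriv v f) := by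
  have hV := (contMDiff_mulInvariantVectorField (I := 𝓘(ℝ, E)) (G := G) v).of_le
    (m := m) (by simpa using hm)
  exact (contMDiff_snd_tangentBundle_modelSpace ℝ 𝓘(ℝ, ℝ)).comp
    ((hf.contMDiff_tangentMap hmn).comp hV)

end LeftInvariant

section Exponential

variable {E : Type*} [NormedAddCommGroup E] [NormedSpace ℝ E] [FiniteDimensional ℝ E]
  {G : Type*} [TopologicalSpace G] [ChartedSpace E G] [Group G] [LieGroup 𝓘(ℝ, E) ∞ G] [T2Space G]

theorem isMIntegralCurve_lieExp (v : GroupLieAlgebra 𝓘(ℝ, E) G) :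
    IsMIntegralCurve (fun t : ℝ => (lieExp (t • v) : G)) (mulInvariantVectorField v) := by
  obtain ⟨γ, h0, hγ⟩ := exists_isMIntegralCurve_one (G := G) v
  have h : (fun t : ℝ => (lieExp (t • v) : G)) = γ := by
    funext t
    have h1 := hγ.comp_mul t
    rw [← mulInvariantVectorField_smul] at h1
    simpa using lieExp_eq (t • v) (by simp [h0]) h1
  rwa [h]

theorem lieExp_zero_smul (v : GroupLieAlgebra 𝓘(ℝ, E) G) :
    (lieExp ((0 : ℝ) • v) : G) = 1 := by
  obtain ⟨γ, h0, hγ⟩ := exists_isMIntegralCurve_one (G := G) v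
  have h1 := hγ.comp_mul 0
  rw [← mulInvariantVectorField_smul] at h1
  simpa [h0] using lieExp_eq ((0 : ℝ) • v) (by simp [h0]) h1

theorem lieExp_zero : (lieExp (0 : GroupLieAlgebra 𝓘(ℝ, E) G) : G) = 1 := by
  simpa using lieExp_zero_smul (G := G) (0 : GroupLieAlgebra 𝓘(ℝ, E) G)

/-- Integral curves of a left-invariant vector field with the same starting point agree, so `γ` is
the one-parameter group of `v`. -/
theorem eq_lieExp_of_isMIntegralCurve {v : GroupLieAlgebra 𝓘(ℝ, E) G} {γ : ℝ → G} (h0 : γ 0 = 1)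
    (hγ : IsMIntegralCurve γ (mulInvariantVectorField v)) (t : ℝ) : γ t = lieExp (t • v) := by
  have : CompleteSpace E := FiniteDimensional.complete ℝ E
  exact congrFun (isMIntegralCurve_Ioo_eq_of_contMDiff_boundaryless (t₀ := 0)
    (contMDiff_one_mulInvariantVectorField v) hγ (isMIntegralCurve_lieExp v)
    (h0.trans (lieExp_zero_smul v).symm)) t

theorem lieExp_add_smul (v : GroupLieAlgebra 𝓘(ℝ, E) G) (s t : ℝ) :
    (lieExp ((s + t) • v) : G) = lieExp (s • v) * lieExp (t • v) := by
  have hγ := (isMIntegralCurve_lieExp (G := G) v).comp_add s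
  rw [isMIntegralCurve_iff_isMIntegralCurveOn] at hγ
  have h := isMIntegralCurveOn_mul_left hγ (lieExp (s • v))⁻¹
  rw [← isMIntegralCurve_iff_isMIntegralCurveOn] at h
  have := eq_lieExp_of_isMIntegralCurve (by simp) h t
  simp only [Function.comp_apply] at this
  rw [← this, mul_inv_cancel_left, add_comm]

theorem lieExp_nat_smul (v : GroupLieAlgebra 𝓘(ℝ, E) G) (n : ℕ) :
    (lieExp ((n : ℝ) • v) : G) = lieExp v ^ n := by
  induction n with
  | zero => simpa using lieExp_zero
  | succ n ih => rw [Nat.cast_succ, lieExp_add_smul, ih, one_smul, pow_succ]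

theorem lieExp_neg_smul (v : GroupLieAlgebra 𝓘(ℝ, E) G) (t : ℝ) :
    (lieExp ((-t) • v) : G) = (lieExp (t • v))⁻¹ := by
  rw [eq_inv_iff_mul_eq_one, ← lieExp_add_smul, neg_add_cancel, lieExp_zero_smul]

/-- The one-parameter subgroup generated by `v`. -/
def oneParameterSubgroup (v : GroupLieAlgebra 𝓘(ℝ, E) G) : Subgroup G where
  carrier := range fun t : ℝ => lieExp (t • v)
  one_mem' := ⟨0, lieExp_zero_smul v⟩
  mul_mem' := by
    rintro _ _ ⟨s, rfl⟩ ⟨t, rfl⟩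
    exact ⟨s + t, lieExp_add_smul v s t⟩
  inv_mem' := by
    rintro _ ⟨t, rfl⟩
    exact ⟨-t, lieExp_neg_smul v t⟩

/-- A vector is determined by its one-parameter group, being the velocity of that curve at `0`. -/
theorem eq_of_lieExp_smul_eq {v w : GroupLieAlgebra 𝓘(ℝ, E) G}
    (h : ∀ t : ℝ, (lieExp (t • v) : G) = lieExp (t • w)) : v = w := by
  have hv := isMIntegralCurve_lieExp (G := G) v 0
  have hw := isMIntegralCurve_lieExp (G := G) w 0
  rw [← funext h] at hw
  have key : ∀ (u : GroupLieAlgebra 𝓘(ℝ, E) G) (g : G), g = 1 →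
      (mulInvariantVectorField u g : E) = u := by
    rintro u g rfl
    have e : (fun x : G => 1 * x) = id := funext one_mul
    rw [mulInvariantVectorField, e, mfderiv_id]
    rfl
  have h1 : ∀ u : GroupLieAlgebra 𝓘(ℝ, E) G, ((1 : ℝ →L[ℝ] ℝ).smulRight
      (mulInvariantVectorField u (lieExp ((0 : ℝ) • v) : G) : E)) (1 : ℝ) =
      (mulInvariantVectorField u (lieExp ((0 : ℝ) • v) : G) : E) := fun u => by
    rw [ContinuousLinearMap.smulRight_apply, one_apply_eq_self, one_smul]
  have h2 : (mulInvariantVectorField v (lieExp ((0 : ℝ) • v) : G) : E) =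
      (mulInvariantVectorField w (lieExp ((0 : ℝ) • v) : G) : E) :=
    ((h1 v).symm.trans (DFunLike.congr_fun (hasMFDerivAt_unique hv hw) (1 : ℝ))).trans (h1 w)
  rw [key _ _ (lieExp_zero_smul v), key _ _ (lieExp_zero_smul v)] at h2
  exact h2

/-- A smooth homomorphism intertwines the exponential map with its differential. -/
theorem map_lieExp {φ : G →* G} (hφ : ContMDiff 𝓘(ℝ, E) 𝓘(ℝ, E) ∞ φ)
    (v : GroupLieAlgebra 𝓘(ℝ, E) G) : φ (lieExp v) = lieExp (lieDiff φ v) := by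
  have hm (a b : G) : MDifferentiableAt 𝓘(ℝ, E) 𝓘(ℝ, E) (fun x : G => a * x) b :=
    (contMDiff_mul_left (I := 𝓘(ℝ, E)) (n := ∞) (a := a)).mdifferentiableAt (by simp)
  have hd (b : G) : MDifferentiableAt 𝓘(ℝ, E) 𝓘(ℝ, E) φ b := hφ.mdifferentiableAt (by simp)
  -- `φ` maps the left-invariant field of `v` to that of its image.
  have key (g : G) : (mulInvariantVectorField (lieDiff φ v) (φ g) : E) =
      mfderiv 𝓘(ℝ, E) 𝓘(ℝ, E) φ g (mulInvariantVectorField v g) := by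
    have e : (fun x : G => φ g * x) ∘ φ = φ ∘ (fun x : G => g * x) := by
      funext x
      simp
    have h1 := mfderiv_comp_apply (I'' := 𝓘(ℝ, E)) (1 : G) (hm (φ g) (φ 1)) (hd 1) v
    have h2 := mfderiv_comp_apply (I'' := 𝓘(ℝ, E)) (1 : G) (hd (g * 1)) (hm g 1) v
    rw [e] at h1
    -- The base points `g * 1` and `φ 1` are only propositionally equal to `g` and `1`.
    have h3 : ∀ b : G, b = g → ∀ w : E,
        (mfderiv 𝓘(ℝ, E) 𝓘(ℝ, E) φ b : E → E) w = (mfderiv 𝓘(ℝ, E) 𝓘(ℝ, E) φ g : E → E) w := by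
      rintro b rfl w
      rfl
    have h4 : ∀ b : G, b = 1 → ∀ w : E,
        (mfderiv 𝓘(ℝ, E) 𝓘(ℝ, E) (fun x : G => φ g * x) b : E → E) w =
          (mfderiv 𝓘(ℝ, E) 𝓘(ℝ, E) (fun x : G => φ g * x) 1 : E → E) w := by
      rintro b rfl w
      rfl
    exact ((h4 _ (map_one φ) _).symm.trans (h1.symm.trans h2)).trans (h3 _ (mul_one g) _)
  have hγ : IsMIntegralCurve (fun t : ℝ => φ (lieExp (t • v)))
      (mulInvariantVectorField (lieDiff φ v)) := by
    intro t
    have h2 := (hd (lieExp (t • v))).hasMFDerivAt.comp t (isMIntegralCurve_lieExp v t)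
    refine h2.congr_mfderiv (ContinuousLinearMap.ext fun a => ?_)
    refine Eq.trans ?_ (congrArg (fun z : E => (show ℝ from a) • z) (key _).symm)
    exact map_smul (mfderiv 𝓘(ℝ, E) 𝓘(ℝ, E) φ (lieExp (t • v))) (show ℝ from a) _
  simpa using eq_lieExp_of_isMIntegralCurve (by simp [lieExp_zero]) hγ 1

theorem lieExp_lieAd (g : G) (v : GroupLieAlgebra 𝓘(ℝ, E) G) :
    (lieExp (lieAd g v) : G) = g * lieExp v * g⁻¹ := by
  have hφ : ContMDiff 𝓘(ℝ, E) 𝓘(ℝ, E) ∞ (MulAut.conj g).toMonoidHom :=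
    (contMDiff_mul_right (I := 𝓘(ℝ, E)) (n := ∞) (a := g⁻¹)).comp
      (contMDiff_mul_left (I := 𝓘(ℝ, E)) (n := ∞) (a := g))
  exact (map_lieExp hφ v).symm

/-- `𝔨` is the Lie algebra of `K`. -/
theorem mem_lieK_iff {θ : G →* G} (hθ : ContMDiff 𝓘(ℝ, E) 𝓘(ℝ, E) ∞ θ)
    {v : GroupLieAlgebra 𝓘(ℝ, E) G} :
    v ∈ lieK E θ ↔ ∀ t : ℝ, lieExp (t • v) ∈ fixedK θ := by
  have hK (t : ℝ) : lieExp (t • v) ∈ fixedK θ ↔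
      (lieExp (t • lieDiff θ v) : G) = lieExp (t • v) := by
    rw [← map_smul, ← map_lieExp hθ]
    rfl
  simp only [hK, lieK, Module.End.mem_eigenspace_iff, one_smul]
  exact ⟨fun h t => by rw [h], eq_of_lieExp_smul_eq⟩

/-! ### Functions along one-parameter groups -/

theorem hasDerivAt_comp_lieExp {f : G → ℝ} (hf : MDifferentiable 𝓘(ℝ, E) 𝓘(ℝ, ℝ) f)
    (v : GroupLieAlgebra 𝓘(ℝ, E) G) (t : ℝ) :
    HasDerivAt (fun s : ℝ => f (lieExp (s • v))) (leftDeriv v f (lieExp (t • v))) t := by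
  have h : HasFDerivAt (𝕜 := ℝ) (E := ℝ) (F := ℝ) (fun s : ℝ => f (lieExp (s • v)))
      ((mfderiv 𝓘(ℝ, E) 𝓘(ℝ, ℝ) f (lieExp (t • v)) : E →L[ℝ] ℝ).comp
        ((1 : ℝ →L[ℝ] ℝ).smulRight (mulInvariantVectorField v (lieExp (t • v)) : E))) t :=
    ((hf (lieExp (t • v))).hasMFDerivAt.comp t (isMIntegralCurve_lieExp v t)).hasFDerivAt
  rw [hasDerivAt_iff_hasFDerivAt]
  refine h.congr_fderiv (ContinuousLinearMap.ext_ring ?_)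
  rw [ContinuousLinearMap.comp_apply, ContinuousLinearMap.smulRight_apply, one_apply_eq_self,
    one_smul]
  exact (one_smul ℝ (leftDeriv v f (lieExp (t • v)))).symm

/-- Along one-parameter groups a smooth function is twice continuously differentiable, so that
`iteratedDeriv 2` is a genuine second derivative there. -/
theorem contDiff_two_comp_lieExp {f : G → ℝ} (hf : ContMDiff 𝓘(ℝ, E) 𝓘(ℝ, ℝ) ∞ f)
    (v : GroupLieAlgebra 𝓘(ℝ, E) G) : ContDiff ℝ 2 (fun s : ℝ => f (lieExp (s • v))) := by
  have h1 := contMDiff_leftDeriv hf (m := 2)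
    (by
      rw [show (2 + 1 : ℕ∞ω) = ((3 : ℕ∞) : ℕ∞ω) by norm_num]
      exact_mod_cast le_top) le_rfl v
  have h2 := contMDiff_leftDeriv h1 (m := 1) (by norm_num) (by norm_num) v
  have d1 := hasDerivAt_comp_lieExp (hf.mdifferentiable (by simp)) v
  have d2 := hasDerivAt_comp_lieExp (h1.mdifferentiable (by simp)) v
  have c2 := h2.continuous.comp (isMIntegralCurve_lieExp v).continuous
  rw [show (2 : ℕ∞ω) = 1 + 1 by norm_num, contDiff_succ_iff_deriv]
  refine ⟨fun t => (d1 t).differentiableAt, by simp, ?_⟩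
  rw [funext fun t => (d1 t).deriv, contDiff_one_iff_deriv, funext fun t => (d2 t).deriv]
  exact ⟨fun t => (d2 t).differentiableAt, c2⟩

end Exponential

/-! ### Convex functions on a line and on a finite-dimensional space -/

section Convex

/-- A convex function that increases somewhere is unbounded above on the positive half-line. -/
theorem exists_pos_lt_of_convexOn {f : ℝ → ℝ} (hf : ConvexOn ℝ univ f) {a b : ℝ} (hab : a < b)
    (h : f a < f b) (C : ℝ) : ∃ t > 0, C < f t := by
  have hm : 0 < (f b - f a) / (b - a) := div_pos (sub_pos.2 h) (sub_pos.2 hab)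
  set m := (f b - f a) / (b - a)
  -- `f` lies above the line of slope `m` through `(b, f b)` to the right of `b`; take `b + s`
  -- positive and beyond the point where this line reaches the value `C`.
  set s := max 1 (max (1 - b) ((C - f b) / m + 1))
  have s1 : 1 ≤ s := le_max_left _ _
  have s2 : 1 - b ≤ s := (le_max_left _ _).trans (le_max_right _ _)
  have s3 : (C - f b) / m + 1 ≤ s := (le_max_right _ _).trans (le_max_right _ _)
  have key := hf.slope_mono_adjacent (mem_univ a) (mem_univ (b + s)) hab (by linarith)
  rw [add_sub_cancel_left, le_div_iff₀ (by linarith)] at key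
  have : C - f b < s * m := (div_lt_iff₀ hm).1 (by linarith)
  refine ⟨b + s, by linarith, ?_⟩
  have : m * s ≤ f (b + s) - f b := key
  linarith

/-- A convex function attaining its minimum at both `0` and `1` is constant in between, so its
second derivative at `0` vanishes by continuity. -/
theorem iteratedDeriv_two_eq_zero_of_convexOn {f : ℝ → ℝ} (hf : ContDiff ℝ 2 f)
    (hc : ConvexOn ℝ univ f) (hmin : ∀ t, f 0 ≤ f t) (h1 : f 1 ≤ f 0) :
    iteratedDeriv 2 f 0 = 0 := by
  have hconst : ∀ t ∈ Ioo (0 : ℝ) 1, f t = f 0 := fun t ht => by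
    refine le_antisymm ?_ (hmin t)
    have := hc.2 (mem_univ 0) (mem_univ 1) (sub_nonneg.2 ht.2.le) ht.1.le
      (sub_add_cancel 1 t)
    simp only [smul_eq_mul, mul_zero, mul_one, zero_add] at this
    nlinarith [ht.1]
  have hzero : Ioo (0 : ℝ) 1 ⊆ {t | iteratedDeriv 2 f t = 0} := fun t ht => by
    have h : f =ᶠ[𝓝 t] fun _ => f 0 :=
      (isOpen_Ioo.mem_nhds ht |> Filter.eventually_of_mem) hconst
    simpa [iteratedDeriv_const] using h.iteratedDeriv_eq 2
  have hcl : IsClosed {t | iteratedDeriv 2 f t = 0} :=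
    isClosed_eq (hf.continuous_iteratedDeriv 2 le_rfl) continuous_const
  refine closure_minimal hzero hcl ?_
  rw [closure_Ioo zero_ne_one]
  exact left_mem_Icc.2 zero_le_one

/-- A function convex along rays has bounded sublevel sets as soon as it exceeds its value at the
origin somewhere on each ray: unbounded points `u n` of a sublevel set would have directions
accumulating at some `v`, and convexity would bound the function by its value at the origin on the
whole ray through `v`. -/
theorem isCompact_sublevel_of_convexOn_rays_of_normed {W : Type*}
    [NormedAddCommGroup W] [NormedSpace ℝ W] [ProperSpace W] {F : W → ℝ}
    (hF : Continuous F) (hconv : ∀ u, ConvexOn ℝ univ (fun t : ℝ => F (t • u)))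
    (h : ∀ u ≠ 0, ∃ t > (0 : ℝ), F 0 < F (t • u)) (C : ℝ) : IsCompact {u | F u ≤ C} := by
  refine Metric.isCompact_of_isClosed_isBounded (isClosed_le hF continuous_const) ?_
  by_contra hb
  have hex : ∀ n : ℕ, ∃ u, F u ≤ C ∧ (n : ℝ) + 1 < ‖u‖ := fun n => by
    by_contra! hn
    exact hb (isBounded_iff_forall_norm_le.2 ⟨n + 1, fun u hu => hn u hu⟩)
  choose u hu hn using hex
  have hpos : ∀ n, 0 < ‖u n‖ := fun n => lt_trans (by positivity) (hn n)
  have hsph : ∀ n, ‖u n‖⁻¹ • u n ∈ Metric.sphere (0 : W) 1 := fun n => by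
    rw [mem_sphere_zero_iff_norm, norm_smul, norm_inv, norm_norm, inv_mul_cancel₀ (hpos n).ne']
  obtain ⟨v, hv, φ, hφ, hlim⟩ := (isCompact_sphere (0 : W) 1).tendsto_subseq hsph
  have hv0 : v ≠ 0 := by
    rintro rfl
    simp at hv
  obtain ⟨t, ht, hlt⟩ := h v hv0
  have hnorm : Tendsto (fun n => ‖u (φ n)‖⁻¹) atTop (𝓝 0) :=
    ((tendsto_atTop_mono (fun n => (hn n).le)
      (tendsto_atTop_add_const_right _ _ tendsto_natCast_atTop_atTop)).comp
        hφ.tendsto_atTop).inv_tendsto_atTop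
  have hsmall : ∀ᶠ n in atTop, t * ‖u (φ n)‖⁻¹ ≤ 1 := by
    have := hnorm.const_mul t
    rw [mul_zero] at this
    exact (this.eventually (gt_mem_nhds one_pos)).mono fun n hn => hn.le
  have hbound : ∀ᶠ n in atTop, F (t • (‖u (φ n)‖⁻¹ • u (φ n))) ≤
      (1 - t * ‖u (φ n)‖⁻¹) * F 0 + t * ‖u (φ n)‖⁻¹ * C := by
    filter_upwards [hsmall] with n hn
    have hnn : 0 ≤ t * ‖u (φ n)‖⁻¹ := by positivity
    have := (hconv (u (φ n))).2 (mem_univ 0) (mem_univ 1) (sub_nonneg.2 hn) hnn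
      (sub_add_cancel 1 _)
    simp only [smul_eq_mul, mul_zero, mul_one, zero_add, zero_smul, one_smul] at this
    rw [smul_smul]
    exact this.trans (by gcongr; exact hu _)
  have hlim1 : Tendsto (fun n => F (t • (‖u (φ n)‖⁻¹ • u (φ n)))) atTop (𝓝 (F (t • v))) :=
    (hF.tendsto _).comp (hlim.const_smul t)
  have hlim2 : Tendsto (fun n => (1 - t * ‖u (φ n)‖⁻¹) * F 0 + t * ‖u (φ n)‖⁻¹ * C) atTop
      (𝓝 (F 0)) := by
    have := (((hnorm.const_mul t).const_sub 1).mul_const (F 0)).add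
      ((hnorm.const_mul t).mul_const C)
    simpa using this
  exact (le_of_tendsto_of_tendsto hlim1 hlim2 hbound).not_gt hlt

variable {W : Type*} [AddCommGroup W] [Module ℝ W] [TopologicalSpace W] [IsTopologicalAddGroup W]
  [ContinuousSMul ℝ W] [T2Space W] [FiniteDimensional ℝ W]

/-- The same criterion with no norm chosen, in the form needed for subspaces of a tangent space,
which carry only a topology. -/
theorem isCompact_sublevel_of_convexOn_rays {F : W → ℝ}
    (hF : Continuous F) (hconv : ∀ u, ConvexOn ℝ univ (fun t : ℝ => F (t • u)))
    (h : ∀ u ≠ 0, ∃ t > (0 : ℝ), F 0 < F (t • u)) (C : ℝ) : IsCompact {u | F u ≤ C} := by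
  let e := (toEuclidean (E := W)).symm
  have hc := isCompact_sublevel_of_convexOn_rays_of_normed (F := fun u => F (e u))
    (hF.comp e.continuous) (fun u => by simpa using hconv (e u))
    (fun u hu => by simpa using h (e u) (by simpa using hu)) C
  exact e.toHomeomorph.isCompact_preimage.1 hc

theorem eq_zero_of_nat_smul_mem_isCompact {S : Set W} (hS : IsCompact S) {w : W}
    (h : ∀ n : ℕ, (n : ℝ) • w ∈ S) : w = 0 := by
  obtain ⟨R, hR⟩ := (hS.image (toEuclidean (E := W)).continuous).isBounded.exists_norm_le
  by_contra hw
  have hw' : toEuclidean w ≠ 0 := by simpa using hw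
  obtain ⟨n, hn⟩ := exists_nat_gt (R / ‖toEuclidean w‖)
  have h1 := hR _ (mem_image_of_mem _ (h n))
  rw [map_smul, norm_smul, Real.norm_natCast] at h1
  exact h1.not_gt ((div_lt_iff₀ (norm_pos_iff.2 hw')).1 hn)

end Convex

/-! ### The Cartan decomposition -/

instance instT2SpaceGroupLieAlgebra {E : Type*} [NormedAddCommGroup E] [NormedSpace ℝ E]
    {G : Type*} [TopologicalSpace G] [ChartedSpace E G] [Group G] :
    T2Space (GroupLieAlgebra 𝓘(ℝ, E) G) :=
  inferInstanceAs (T2Space E)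

instance instFiniteDimensionalGroupLieAlgebra {E : Type*} [NormedAddCommGroup E] [NormedSpace ℝ E]
    [FiniteDimensional ℝ E] {G : Type*} [TopologicalSpace G] [ChartedSpace E G] [Group G] :
    FiniteDimensional ℝ (GroupLieAlgebra 𝓘(ℝ, E) G) :=
  inferInstanceAs (FiniteDimensional ℝ E)

section Cartan

variable {E : Type*} [NormedAddCommGroup E] [NormedSpace ℝ E] [FiniteDimensional ℝ E]
  [CompleteSpace E] {G : Type*} [TopologicalSpace G] [ChartedSpace E G] [Group G]
  [LieGroup 𝓘(ℝ, E) ∞ G] [T2Space G] {θ : G →* G}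

theorem IsRealReductive.exists_mul_lieExp (hG : IsRealReductive E θ) (g : G) :
    ∃ k ∈ fixedK θ, ∃ u ∈ lieP E θ, k * lieExp u = g := by
  obtain ⟨⟨k, u⟩, h⟩ := hG.cartan.surjective g
  exact ⟨k, k.2, u, u.2, h⟩

theorem IsRealReductive.isClosedEmbedding_lieExp (hG : IsRealReductive E θ) :
    IsClosedEmbedding (fun u : lieP E θ => (lieExp (u : GroupLieAlgebra 𝓘(ℝ, E) G) : G)) := by
  have h1 : IsClosedEmbedding (fun u : lieP E θ => ((1 : fixedK θ), u)) :=
    ⟨isEmbedding_prodMkRight _, by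
      have : range (fun u : lieP E θ => ((1 : fixedK θ), u)) = {1} ×ˢ univ := by
        ext ⟨k, u⟩
        simp [eq_comm]
      rw [this]
      exact isClosed_singleton.prod isClosed_univ⟩
  have h2 := hG.cartan.isClosedEmbedding.comp h1
  have e : (fun q : fixedK θ × lieP E θ =>
      (q.1 : G) * lieExp (q.2 : GroupLieAlgebra 𝓘(ℝ, E) G)) ∘
        (fun u : lieP E θ => ((1 : fixedK θ), u)) =
      fun u : lieP E θ => (lieExp (u : GroupLieAlgebra 𝓘(ℝ, E) G) : G) := by
    funext u
    simp
  rwa [e] at h2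

theorem IsRealReductive.eq_zero_of_pow_lieExp_mem_isCompact (hG : IsRealReductive E θ) {S : Set G}
    (hS : IsCompact S) {w : GroupLieAlgebra 𝓘(ℝ, E) G} (hw : w ∈ lieP E θ)
    (h : ∀ n : ℕ, lieExp w ^ n ∈ S) : w = 0 := by
  have hc : IsCompact ((fun u : lieP E θ => (lieExp (u : GroupLieAlgebra 𝓘(ℝ, E) G) : G)) ⁻¹' S) :=
    hG.isClosedEmbedding_lieExp.isCompact_preimage hS
  have := eq_zero_of_nat_smul_mem_isCompact (w := (⟨w, hw⟩ : lieP E θ)) hc fun n => by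
    have := h n
    rwa [← lieExp_nat_smul] at this
  exact congrArg Subtype.val this

theorem IsRealReductive.eq_zero_of_conj_mem_fixedK (hG : IsRealReductive E θ) (c : G)
    {v : GroupLieAlgebra 𝓘(ℝ, E) G} (hv : v ∈ lieP E θ)
    (h : ∀ t : ℝ, c * lieExp (t • v) * c⁻¹ ∈ fixedK θ) : v = 0 := by
  have := topologicalGroup_of_lieGroup 𝓘(ℝ, E) ∞ (G := G)
  have hc : IsCompact ((fun k => c⁻¹ * k * c) '' (fixedK θ : Set G)) :=
    hG.isCompact_K.image (by fun_prop)
  refine hG.eq_zero_of_pow_lieExp_mem_isCompact hc hv fun n => ⟨_, h n, ?_⟩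
  rw [← lieExp_nat_smul]
  group

theorem IsRealReductive.isClosed_lieExp_image (hG : IsRealReductive E θ)
    {V : Submodule ℝ (GroupLieAlgebra 𝓘(ℝ, E) G)} (hV : V ≤ lieP E θ) :
    IsClosed ((lieExp : GroupLieAlgebra 𝓘(ℝ, E) G → G) '' (V : Set _)) := by
  have hcl : IsClosed (V : Set (GroupLieAlgebra 𝓘(ℝ, E) G)) := V.closed_of_finiteDimensional
  have h := hG.isClosedEmbedding_lieExp.isClosedMap _ (hcl.preimage continuous_subtype_val)
  convert h using 1
  ext g
  constructor
  · rintro ⟨v, hv, rfl⟩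
    exact ⟨⟨v, hV hv⟩, hv, rfl⟩
  · rintro ⟨v, hv, rfl⟩
    exact ⟨v, hv, rfl⟩

end Cartan

/-! ### Kempf-Ness functions -/

/-- The Kempf-Ness function of the point `x` is proper and bounded below: each of its sublevel sets
in `G` is compact. -/
def HasCompactSublevels {G M : Type*} [TopologicalSpace G] (Ψ : M → G → ℝ) (x : M) : Prop :=
  ∀ C : ℝ, IsCompact {g | Ψ x g ≤ C}

section KempfNess

variable {E : Type*} [NormedAddCommGroup E] [NormedSpace ℝ E] [FiniteDimensional ℝ E]
  {G : Type*} [TopologicalSpace G] [ChartedSpace E G] [Group G]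
  [LieGroup 𝓘(ℝ, E) ∞ G] [T2Space G] {θ : G →* G}
  {M : Type*} [TopologicalSpace M] [MulAction G M] {Ψ : M → G → ℝ}

namespace IsKempfNess

theorem apply_one (hΨ : IsKempfNess E θ Ψ) (x : M) : Ψ x 1 = 0 := by
  have := hΨ.cocycle x 1 1
  rw [one_smul, one_mul] at this
  linarith

theorem apply_smul (hΨ : IsKempfNess E θ Ψ) (x : M) (g h : G) :
    Ψ (g • x) h = Ψ x (h * g) - Ψ x g := by
  rw [← hΨ.cocycle x g h, add_sub_cancel_left]

theorem convexOn_lieExp (hΨ : IsKempfNess E θ Ψ) (x : M) {v : GroupLieAlgebra 𝓘(ℝ, E) G}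
    (hv : v ∈ lieP E θ) : ConvexOn ℝ univ (fun t : ℝ => Ψ x (lieExp (t • v))) := by
  have h2 := contDiff_two_comp_lieExp (hΨ.smooth x) v
  refine convexOn_univ_of_deriv2_nonneg (h2.differentiable (by simp)) ?_ fun t => ?_
  · exact (h2.iterate_deriv' 1 1).differentiable (by simp)
  · rw [← iteratedDeriv_eq_iterate]
    exact hΨ.convex x v hv t

/-- If the minimum along the curve `t ↦ exp (t v)` is attained at both `0` and `1`, then the
whole one-parameter group of `v` fixes `x`: the second derivative vanishes at `0`. -/
theorem forall_lieExp_mem_stabilizer (hΨ : IsKempfNess E θ Ψ) {x : M}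
    {v : GroupLieAlgebra 𝓘(ℝ, E) G} (hv : v ∈ lieP E θ) (hmin : ∀ t : ℝ, 0 ≤ Ψ x (lieExp (t • v)))
    (h : Ψ x (lieExp v) ≤ 0) (t : ℝ) : lieExp (t • v) ∈ MulAction.stabilizer G x := by
  have h0 : Ψ x (lieExp ((0 : ℝ) • v)) = 0 := by rw [lieExp_zero_smul, hΨ.apply_one]
  exact (hΨ.convex_eq_zero_iff x v hv).1 (iteratedDeriv_two_eq_zero_of_convexOn
    (contDiff_two_comp_lieExp (hΨ.smooth x) v) (hΨ.convexOn_lieExp x hv)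
    (fun t => by rw [h0]; exact hmin t) (by rwa [h0, one_smul])) t

theorem pos_of_gradientMap_eq_zero (hΨ : IsKempfNess E θ Ψ) {x : M}
    {v : GroupLieAlgebra 𝓘(ℝ, E) G} (hv : v ∈ lieP E θ) (hgrad : gradientMap Ψ x v = 0)
    (hstab : ¬ ∀ t : ℝ, lieExp (t • v) ∈ MulAction.stabilizer G x) : 0 < Ψ x (lieExp v) := by
  by_contra! h
  refine hstab (hΨ.forall_lieExp_mem_stabilizer hv (fun t => ?_) h)
  have h2 := contDiff_two_comp_lieExp (hΨ.smooth x) v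
  have hd := (h2.differentiable (by simp) 0).hasDerivAt
  rw [show deriv (fun s : ℝ => Ψ x (lieExp (s • v))) 0 = 0 from hgrad] at hd
  have := (hΨ.convexOn_lieExp x hv).isMinOn_of_rightDeriv_eq_zero (x := 0) (by simp)
    (hd.hasDerivWithinAt.derivWithin (uniqueDiffWithinAt_Ioi 0)) (mem_univ t)
  simpa [lieExp_zero, hΨ.apply_one] using this

/-- If the minimum of the Kempf-Ness function of `x` on a subgroup `H` is attained at `h`, then the
gradient map at `h • x` vanishes in the directions of `H`. -/
theorem isPolystable_of_forall_le (hΨ : IsKempfNess E θ Ψ) {x : M} {H : Subgroup G} {h : G}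
    (hh : h ∈ H) (hmin : ∀ g ∈ H, Ψ x h ≤ Ψ x g) : IsPolystable E θ Ψ H x := by
  refine ⟨h, hh, fun v hv _ => IsLocalMin.deriv_eq_zero (Eventually.of_forall fun t => ?_)⟩
  simp only [lieExp_zero_smul, hΨ.apply_one, hΨ.apply_smul, sub_nonneg]
  exact hmin _ (H.mul_mem (hv t) hh)

end IsKempfNess

namespace HasCompactSublevels

theorem smul (hΨ : IsKempfNess E θ Ψ) {x : M} (hx : HasCompactSublevels Ψ x) (g : G) :
    HasCompactSublevels Ψ (g • x) := fun C => by
  have := topologicalGroup_of_lieGroup 𝓘(ℝ, E) ∞ (G := G)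
  have h := (Homeomorph.mulRight g).isCompact_preimage.2 (hx (C + Ψ x g))
  convert h using 1
  ext h
  simp [hΨ.apply_smul]

theorem exists_forall_le (hΨ : IsKempfNess E θ Ψ) {x : M} (hx : HasCompactSublevels Ψ x)
    {H : Subgroup G} (hH : IsClosed (H : Set G)) : ∃ h ∈ H, ∀ g ∈ H, Ψ x h ≤ Ψ x g := by
  obtain ⟨h, hh, hmin⟩ := ((hx 0).inter_right hH).exists_isMinOn
    ⟨1, (hΨ.apply_one x).le, H.one_mem⟩ (hΨ.smooth x).continuous.continuousOn
  refine ⟨h, hh.2, fun g hg => ?_⟩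
  by_cases hg0 : Ψ x g ≤ 0
  · exact hmin ⟨hg0, hg⟩
  · exact le_trans hh.1 (not_le.1 hg0).le

/-- On the stabilizer of `x` the Kempf-Ness function is an additive character, so it vanishes as
soon as it is bounded below. -/
theorem apply_eq_zero (hΨ : IsKempfNess E θ Ψ) {x : M} (hx : HasCompactSublevels Ψ x) {g : G}
    (hg : g ∈ MulAction.stabilizer G x) : Ψ x g = 0 := by
  obtain ⟨m, -, hm⟩ := exists_forall_le hΨ hx (H := ⊤) isClosed_univ
  have hmul : ∀ a ∈ MulAction.stabilizer G x, ∀ b, Ψ x (b * a) = Ψ x a + Ψ x b := fun a ha b => by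
    rw [← hΨ.cocycle, MulAction.mem_stabilizer_iff.1 ha]
  have hnonneg : ∀ a ∈ MulAction.stabilizer G x, 0 ≤ Ψ x a := fun a ha => by
    have hpow : ∀ n : ℕ, Ψ x (a ^ n) = n * Ψ x a := fun n => by
      induction n with
      | zero => simp [hΨ.apply_one]
      | succ n ih => rw [pow_succ, hmul a ha, ih]; push_cast; ring
    by_contra! hneg
    obtain ⟨n, hn⟩ := exists_nat_gt (Ψ x m / Ψ x a)
    have := hm (a ^ n) trivial
    rw [hpow] at this
    exact this.not_gt ((div_lt_iff_of_neg hneg).1 hn)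
  have h1 := hmul g hg g⁻¹
  rw [inv_mul_cancel, hΨ.apply_one] at h1
  linarith [hnonneg g hg, hnonneg g⁻¹ (inv_mem hg)]

end HasCompactSublevels

variable [CompleteSpace E]

/-- By the Cartan decomposition and the invariance under `K`, properness of the Kempf-Ness function
can be tested along the rays of `𝔭`. -/
theorem hasCompactSublevels_of_rays (hG : IsRealReductive E θ) (hΨ : IsKempfNess E θ Ψ) {x : M}
    (h : ∀ v ∈ lieP E θ, v ≠ 0 → ∃ t > (0 : ℝ), 0 < Ψ x (lieExp (t • v))) :
    HasCompactSublevels Ψ x := fun C => by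
  have : CompactSpace (fixedK θ) := isCompact_iff_compactSpace.1 hG.isCompact_K
  have hc := isCompact_sublevel_of_convexOn_rays
    (F := fun u : lieP E θ => Ψ x (lieExp (u : GroupLieAlgebra 𝓘(ℝ, E) G)))
    ((hΨ.smooth x).continuous.comp hG.isClosedEmbedding_lieExp.continuous)
    (fun u => hΨ.convexOn_lieExp x u.2)
    (fun u hu => by
      simpa [lieExp_zero, hΨ.apply_one] using h u u.2 (by simpa using hu)) C
  convert (isCompact_univ.prod hc).image hG.cartan.continuous using 1
  ext g
  constructor
  · intro hg
    obtain ⟨k, hk, u, hu, rfl⟩ := hG.exists_mul_lieExp g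
    rw [mem_ofPred_eq, hΨ.left_invariant _ _ _ hk] at hg
    exact ⟨(⟨k, hk⟩, ⟨u, hu⟩), ⟨trivial, hg⟩, rfl⟩
  · rintro ⟨⟨k, u⟩, ⟨-, hu⟩, rfl⟩
    exact (hΨ.left_invariant _ _ _ k.2).trans_le hu

/-! ### Stability and properness -/

theorem HasCompactSublevels.isStable_top (hG : IsRealReductive E θ) (hΨ : IsKempfNess E θ Ψ)
    {x : M} (hx : HasCompactSublevels Ψ x) : IsStable E θ Ψ ⊤ x := by
  obtain ⟨h, -, hmin⟩ := hx.exists_forall_le hΨ (H := ⊤) isClosed_univ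
  refine ⟨hΨ.isPolystable_of_forall_le trivial hmin, h, trivial, fun v hv =>
    ⟨fun _ => trivial, ?_⟩⟩
  have hy := hx.smul hΨ h
  have hnonneg (g : G) : 0 ≤ Ψ (h • x) g := by
    rw [hΨ.apply_smul, sub_nonneg]
    exact hmin _ trivial
  rw [mem_lieK_iff hG.contMDiff_θ]
  intro t
  have hg : lieExp (t • lieAd h v) ∈ MulAction.stabilizer G (h • x) := by
    rw [← lieAd_smul, lieExp_lieAd, MulAction.stabilizer_smul_eq_stabilizer_map_conj]
    exact ⟨_, (hv t).2, rfl⟩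
  obtain ⟨k, hk, u, hu, hku⟩ := hG.exists_mul_lieExp (lieExp (t • lieAd h v))
  have hzero : Ψ (h • x) (lieExp u) = 0 := by
    rw [← hΨ.left_invariant _ _ k hk, hku, hy.apply_eq_zero hΨ hg]
  have hstab := hΨ.forall_lieExp_mem_stabilizer hu (fun _ => hnonneg _) hzero.le
  have hu0 : u = 0 := hG.eq_zero_of_pow_lieExp_mem_isCompact (hy 0) hu fun n => by
    rw [← lieExp_nat_smul]
    exact (hy.apply_eq_zero hΨ (hstab n)).le
  rwa [← hku, hu0, lieExp_zero, mul_one]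

theorem HasCompactSublevels.isStable_of_le_lieP (hG : IsRealReductive E θ)
    (hΨ : IsKempfNess E θ Ψ) {x : M} (hx : HasCompactSublevels Ψ x)
    {V : Submodule ℝ (GroupLieAlgebra 𝓘(ℝ, E) G)} (hV : V ≤ lieP E θ) {A : Subgroup G}
    (hA : (A : Set G) = lieExp '' (V : Set (GroupLieAlgebra 𝓘(ℝ, E) G))) :
    IsStable E θ Ψ A x := by
  obtain ⟨h, hh, hmin⟩ := hx.exists_forall_le hΨ (H := A) (by
    rw [hA]
    exact hG.isClosed_lieExp_image hV)
  refine ⟨hΨ.isPolystable_of_forall_le hh hmin, 1, one_mem A, fun v hv => ?_⟩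
  have hone (t : ℝ) : (lieExp (t • v) : G) = 1 := by
    obtain ⟨w, hw, hwt⟩ : lieExp (t • v) ∈
        (lieExp : _ → G) '' (V : Set (GroupLieAlgebra 𝓘(ℝ, E) G)) := hA ▸ (hv t).1
    have hw0 : w = 0 := hG.eq_zero_of_pow_lieExp_mem_isCompact (hx 0) (hV hw) fun n =>
      (hx.apply_eq_zero hΨ (pow_mem (hwt ▸ (hv t).2) n)).le
    rw [← hwt, hw0, lieExp_zero]
  have hv0 : v = 0 := eq_of_lieExp_smul_eq (G := G) fun t => by
    rw [hone, smul_zero, lieExp_zero]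
  rw [hv0, lieAd_zero]
  exact ⟨fun t => by rw [smul_zero, lieExp_zero]; exact one_mem A, zero_mem _⟩

theorem IsStable.hasCompactSublevels (hG : IsRealReductive E θ) (hΨ : IsKempfNess E θ Ψ)
    {x : M} (hx : IsStable E θ Ψ ⊤ x) : HasCompactSublevels Ψ x := by
  obtain ⟨⟨h, -, hgrad⟩, c, -, hc⟩ := hx
  suffices HasCompactSublevels Ψ (h • x) by simpa using this.smul hΨ h⁻¹
  refine hasCompactSublevels_of_rays hG hΨ fun v hv hv0 => ⟨1, one_pos, ?_⟩
  rw [one_smul]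
  refine hΨ.pos_of_gradientMap_eq_zero hv (hgrad v (fun _ => trivial) hv) fun hstab => hv0 ?_
  -- Transport `v` back to the Lie algebra of the stabilizer of `x`, and then into `𝔨`.
  have hw : lieAd h⁻¹ v ∈ lieOf (⊤ ⊓ MulAction.stabilizer G x) := fun t => by
    refine ⟨trivial, ?_⟩
    have : h⁻¹ * lieExp (t • v) * h⁻¹⁻¹ ∈ MulAction.stabilizer G x := by
      rw [MulAction.mem_stabilizer_iff, inv_inv, mul_smul, mul_smul,
        MulAction.mem_stabilizer_iff.1 (hstab t), inv_smul_smul]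
    rwa [← lieAd_smul, lieExp_lieAd]
  have hk := (mem_lieK_iff hG.contMDiff_θ).1 (hc _ hw).2
  refine hG.eq_zero_of_conj_mem_fixedK (c * h⁻¹) hv fun t => ?_
  have := hk t
  rw [← lieAd_smul, ← lieAd_smul, lieExp_lieAd, lieExp_lieAd] at this
  simpa [mul_assoc] using this

/-- The one-dimensional subalgebra spanned by `v`. -/
noncomputable def lieLine (v : GroupLieAlgebra 𝓘(ℝ, E) G) :
    LieSubalgebra ℝ (GroupLieAlgebra 𝓘(ℝ, E) G) where
  toSubmodule := ℝ ∙ v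
  lie_mem' := by
    intro a b ha hb
    obtain ⟨r, rfl⟩ := Submodule.mem_span_singleton.1 ha
    obtain ⟨s, rfl⟩ := Submodule.mem_span_singleton.1 hb
    simp

theorem coe_oneParameterSubgroup (v : GroupLieAlgebra 𝓘(ℝ, E) G) :
    (oneParameterSubgroup v : Set G) = lieExp '' (lieLine v : Set (GroupLieAlgebra 𝓘(ℝ, E) G)) := by
  have : (lieLine v : Set (GroupLieAlgebra 𝓘(ℝ, E) G)) = range fun t : ℝ => t • v := by
    ext w
    exact Submodule.mem_span_singleton
  rw [this, ← range_comp]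
  rfl

/-- Stability along the one-parameter groups of `𝔭` suffices for properness: if the critical point
on `exp (ℝ v)` is `exp (t₀ v)`, the Kempf-Ness function is larger at `exp ((t₀ + 1) v)`, hence
unbounded on the ray. -/
theorem hasCompactSublevels_of_isStable_oneParameterSubgroup (hG : IsRealReductive E θ)
    (hΨ : IsKempfNess E θ Ψ) {x : M}
    (h : ∀ v ∈ lieP E θ, IsStable E θ Ψ (oneParameterSubgroup v) x) :
    HasCompactSublevels Ψ x := by
  refine hasCompactSublevels_of_rays hG hΨ fun v hv hv0 => ?_
  obtain ⟨⟨_, ⟨t₀, rfl⟩, hgrad⟩, c, -, hc⟩ := h v hv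
  have hpos : 0 < Ψ (lieExp (t₀ • v) • x) (lieExp v) := by
    refine hΨ.pos_of_gradientMap_eq_zero hv (hgrad v (fun t => ⟨t, rfl⟩) hv) fun hstab => hv0 ?_
    have hw : v ∈ lieOf (oneParameterSubgroup v ⊓ MulAction.stabilizer G x) := fun t => by
      refine ⟨⟨t, rfl⟩, ?_⟩
      have := MulAction.mem_stabilizer_iff.1 (hstab t)
      rwa [← mul_smul, ← lieExp_add_smul, add_comm, lieExp_add_smul, mul_smul,
        smul_left_cancel_iff] at this
    have hk := (mem_lieK_iff hG.contMDiff_θ).1 (hc _ hw).2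
    refine hG.eq_zero_of_conj_mem_fixedK c hv fun t => ?_
    have := hk t
    rwa [← lieAd_smul, lieExp_lieAd] at this
  have e : (lieExp v : G) * lieExp (t₀ • v) = lieExp ((1 + t₀) • v) := by
    rw [lieExp_add_smul, one_smul]
  rw [hΨ.apply_smul, e, sub_pos] at hpos
  exact exists_pos_lt_of_convexOn (hΨ.convexOn_lieExp x hv) (by linarith) hpos 0

end KempfNess

end KempfNess

open KempfNess in
theorem mainTheorem8 {E : Type*} [NormedAddCommGroup E] [NormedSpace ℝ E] [FiniteDimensional ℝ E]
    [CompleteSpace E] {G : Type*} [TopologicalSpace G] [ChartedSpace E G] [Group G]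
    [LieGroup 𝓘(ℝ, E) ∞ G] [T2Space G] [NoncompactSpace G] (θ : G →* G) (hG : IsRealReductive E θ)
    {M : Type*} [TopologicalSpace M] [T2Space M] [MulAction G M] [ContinuousSMul G M]
    (Ψ : M → G → ℝ) (hΨ : IsKempfNess E θ Ψ) (x : M) :
    IsStable E θ Ψ ⊤ x ↔
      ∀ 𝔞 : LieSubalgebra ℝ (GroupLieAlgebra 𝓘(ℝ, E) G), 𝔞.toSubmodule ≤ lieP E θ →
        ∀ A : Subgroup G, (A : Set G) = lieExp '' (𝔞 : Set (GroupLieAlgebra 𝓘(ℝ, E) G)) →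
          IsStable E θ Ψ A x := by
  constructor
  · intro hx 𝔞 h𝔞 A hA
    exact (hx.hasCompactSublevels hG hΨ).isStable_of_le_lieP hG hΨ h𝔞 hA
  · intro h
    refine (hasCompactSublevels_of_isStable_oneParameterSubgroup hG hΨ fun v hv =>
      h (lieLine v) ?_ _ (coe_oneParameterSubgroup v)).isStable_top hG hΨ
    exact (Submodule.span_singleton_le_iff_mem v _).2 hv
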